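/- Let $k$ be a field and let $A=\bigoplus_{i\ge 0}A_i$ be a Koszul $k$-algebra, i.e. an $\mathbb{N}$-graded $k$-algebra such that $A_0$ is semisimple and the graded left $A$-module $A_0=A/\bigoplus_{i\ge1}A_i$, concentrated in degree $0$, is Koszul. Here $\mathrm{Gr}(A)$ is the category of $\mathbb{Z}$-graded left $A$-modules and degree-preserving $A$-linear maps, and $M\in\mathrm{Gr}(A)$ is called Koszul if it has a graded projective resolution $\cdots\to Q^1\to Q^0\to M\to 0$ in which each $Q^i$ is generated in degree $i$, i.e. $Q^i=A\,(Q^i)_i$ (no finite generation is required). For $n\in\mathbb{Z}$, let $M[n]$ be the shifted module with $M[n]_i=M_{i-n}$. Let $\mathcal{C}$ be a full subcategory of $\mathrm{Gr}(A)$. Suppose that for every $X\in\mathcal{C}$ there exist exact sequences in $\mathrm{Gr}(A)$ $$0\to\Omega\to P^0\to X\to 0,\qquad 0\to X''\to X'\to\Omega[-1]\to 0,$$ where $P^0$ is a graded projective $A$-module generated in degree $0$ and $X',X''\in\mathcal{C}$. Then every module in $\mathcal{C}$ is a Koszul $A$-module. -/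

import Mathlib

open CategoryTheory

universe u v w

/-- A graded left module over the `ℕ`-graded `k`-algebra `A = ⨁ 𝒜 i`: a left `A`-module `M`
together with a decomposition `M = ⨁_{i ∈ ℤ} M_i` such that `A_i M_j ⊆ M_{i+j}`.  (The pieces are
automatically `k`-subspaces, because the image of `k` in `A` lies in `A_0`.) -/
structure GrMod {k : Type w} [Field k] {A : Type u} [Ring A] [Algebra k A]
    (𝒜 : ℕ → Submodule k A) [GradedAlgebra 𝒜] where
  carrier : Type v
  [addCommGroup : AddCommGroup carrier]
  [module : Module A carrier]
  deg : ℤ → AddSubgroup carrier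
  isInternal : DirectSum.IsInternal deg
  smul_mem : ∀ (i : ℕ) (j : ℤ) (a : A) (x : carrier),
    a ∈ 𝒜 i → x ∈ deg j → a • x ∈ deg ((i : ℤ) + j)

namespace GrMod

attribute [instance] GrMod.addCommGroup GrMod.module

section Basic

variable {k : Type w} [Field k] {A : Type u} [Ring A] [Algebra k A]
  {𝒜 : ℕ → Submodule k A} [GradedAlgebra 𝒜]

/-- A graded homomorphism: an `A`-linear map `f` with `f (M_i) ⊆ N_i` for all `i`. -/
@[ext]
structure Hom (M N : GrMod.{u, v, w} 𝒜) where
  toLinearMap : M.carrier →ₗ[A] N.carrier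
  map_deg : ∀ (i : ℤ) (x : M.carrier), x ∈ M.deg i → toLinearMap x ∈ N.deg i

/-- The category `Gr(A)` of graded left `A`-modules and graded homomorphisms. -/
instance : Category (GrMod.{u, v, w} 𝒜) where
  Hom := Hom
  id M := ⟨LinearMap.id, fun _ _ h => h⟩
  comp f g := ⟨g.toLinearMap.comp f.toLinearMap,
    fun i x h => g.map_deg i _ (f.map_deg i x h)⟩

/-- The underlying `A`-linear map of a morphism of `Gr(A)`. -/
def lin {M N : GrMod.{u, v, w} 𝒜} (f : M ⟶ N) : M.carrier →ₗ[A] N.carrier :=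
  Hom.toLinearMap f

/-- Exactness of `0 ⟶ L ⟶ M ⟶ N ⟶ 0` in `Gr(A)`. -/
def ShortExactSeq {L M N : GrMod.{u, v, w} 𝒜} (f : L ⟶ M) (g : M ⟶ N) : Prop :=
  Function.Injective (lin f) ∧ Function.Exact (lin f) (lin g) ∧ Function.Surjective (lin g)

/-- `M` is generated in degree `i`, that is, `M = A M_i`. -/
def GeneratedInDegree (M : GrMod.{u, v, w} 𝒜) (i : ℤ) : Prop :=
  Submodule.span A (M.deg i : Set M.carrier) = ⊤

/-- An internal direct sum of subgroups is an independent family that spans. -/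
theorem isInternal_iff {M : Type*} [AddCommGroup M] (d : ℤ → AddSubgroup M) :
    DirectSum.IsInternal d ↔ iSupIndep d ∧ iSup d = ⊤ := by
  have h := DirectSum.isInternal_submodule_iff_iSupIndep_and_iSup_eq_top
    fun i => AddSubgroup.toIntSubmodule (d i)
  have h1 : iSupIndep (fun i => AddSubgroup.toIntSubmodule (d i)) ↔ iSupIndep d :=
    iSupIndep_map_orderIso_iff (AddSubgroup.toIntSubmodule (M := M)) (a := d)
  have h2 : iSup (fun i => AddSubgroup.toIntSubmodule (d i)) = ⊤ ↔ iSup d = ⊤ := by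
    rw [← OrderIso.map_iSup, map_eq_top_iff]
  rw [h1, h2] at h
  exact h

theorem isInternal_reindex {M : Type*} [AddCommGroup M] (d : ℤ → AddSubgroup M)
    (h : DirectSum.IsInternal d) (n : ℤ) : DirectSum.IsInternal fun i => d (i - n) := by
  rw [isInternal_iff] at h ⊢
  exact ⟨h.1.comp (sub_left_injective (b := n)), by
    rw [← h.2]
    exact (Equiv.subRight n).iSup_comp (g := d)⟩

/-- The shift `M[n]`, with `M[n]_i = M_{i-n}`. -/
def shift (M : GrMod.{u, v, w} 𝒜) (n : ℤ) : GrMod.{u, v, w} 𝒜 where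
  carrier := M.carrier
  deg i := M.deg (i - n)
  isInternal := isInternal_reindex M.deg M.isInternal n
  smul_mem i j a x ha hx := by
    have h := M.smul_mem i (j - n) a x ha hx
    rwa [← add_sub_assoc] at h

/-- A linear projective resolution of `M`: a graded projective resolution
`⋯ ⟶ P 2 ⟶ P 1 ⟶ P 0 ⟶ M ⟶ 0` such that `P n` is generated in degree `n`.
No finite generation is required. -/
structure LinearResolution (M : GrMod.{u, v, w} 𝒜) where
  P : ℕ → GrMod.{u, v, w} 𝒜
  d : ∀ n, P (n + 1) ⟶ P n
  ε : P 0 ⟶ M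
  projective : ∀ n, Module.Projective A (P n).carrier
  generated : ∀ n, (P n).GeneratedInDegree (n : ℤ)
  surjective : Function.Surjective (lin ε)
  exact_zero : Function.Exact (lin (d 0)) (lin ε)
  exact_succ : ∀ n, Function.Exact (lin (d (n + 1))) (lin (d n))

/-- `M` is a Koszul module. -/
def IsKoszul (M : GrMod.{u, v, w} 𝒜) : Prop :=
  Nonempty (LinearResolution M)

theorem isInternal_single (M : Type*) [AddCommGroup M] :
    DirectSum.IsInternal fun i : ℤ => if i = 0 then (⊤ : AddSubgroup M) else ⊥ := by
  rw [isInternal_iff]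
  constructor
  · intro i
    by_cases hi : i = 0
    · have h : (⨆ (j : ℤ) (_ : j ≠ i), if j = 0 then (⊤ : AddSubgroup M) else ⊥) = ⊥ := by
        simp only [iSup_eq_bot]
        intro j hj
        rw [if_neg (by rwa [hi] at hj)]
      rw [h]
      exact disjoint_bot_right
    · simp only [if_neg hi]
      exact disjoint_bot_left
  · exact top_unique (le_iSup_of_le 0 (by simp))

end Basic

section Trivial

variable {k : Type w} [Field k] {A : Type u} [Ring A] [Algebra k A]
  (𝒜 : ℕ → Submodule k A) [GradedAlgebra 𝒜]

/-- The trivial module `A_0`: the algebra `A` acts through the projection `A ⟶ A / J = A_0`, where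
`J = ⨁_{i ≥ 1} A_i`, and the module is concentrated in degree `0`. -/
def trivialModule : GrMod.{u, u, w} 𝒜 where
  carrier := 𝒜 0
  module := Module.compHom (𝒜 0) (GradedRing.projZeroRingHom' 𝒜)
  deg i := if i = 0 then ⊤ else ⊥
  isInternal := isInternal_single (𝒜 0)
  smul_mem i j a x ha hx := by
    by_cases hj : j = 0
    · subst hj
      by_cases hi : i = 0
      · subst hi
        simp
      · have h0 : GradedRing.projZeroRingHom' 𝒜 a = 0 := by
          ext
          simp [DirectSum.decompose_of_mem_ne 𝒜 ha hi]
        have h1 : GradedRing.projZeroRingHom' 𝒜 a • x = 0 := by rw [h0, zero_smul]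
        change GradedRing.projZeroRingHom' 𝒜 a • x ∈ _
        rw [h1]
        exact zero_mem _
    · rw [if_neg hj, AddSubgroup.mem_bot] at hx
      rw [hx]
      change GradedRing.projZeroRingHom' 𝒜 a • (0 : 𝒜 0) ∈ _
      rw [smul_zero]
      exact zero_mem _

/-- `A = ⨁ 𝒜 i` is a Koszul algebra: `A_0` is semisimple, and the trivial module `A_0` is Koszul,
that is, it has a graded projective resolution whose `n`-th term is generated in degree `n`. -/
def IsKoszulAlgebra : Prop :=
  IsSemisimpleRing (𝒜 0) ∧ (trivialModule 𝒜).IsKoszul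

end Trivial

end GrMod

/-! Call a cover of a module generated in degree `d` linear if it is by a projective generated in
degree `d` and its kernel vanishes in degree `d`. Since `A_0` is semisimple such covers exist
(`hasLinearCovers`), and a module is Koszul once its iterated syzygies under them are generated in
degrees 0, 1, 2, … (`exists_linearResolution`).

The engine is `exists_shortExactSeq_kernels`: in a short exact sequence of modules generated in
degree `d`, passing to syzygies gives a short exact sequence again. Hence linearity up to step `n`
passes from `X''` and `X'` to the quotient `Y` (`IsLinearUpTo.of_shortExactSeq`).

Now induct on `n` for all of `C` at once. If `X'` and `X''` are linear up to `n`, so is `Ω[-1]`.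
Thus `Ω` is generated in degree 1 and vanishes in degree 0, so `P → X` is a linear cover and `X` is
linear up to `n + 1`. -/

namespace GrMod

/-! ### Graded modules: homogeneous components, graded lifting, kernels, generation in one degree.
-/

section Graded

variable {k : Type w} [Field k] {A : Type u} [Ring A] [Algebra k A]
  {𝒜 : ℕ → Submodule k A} [GradedAlgebra 𝒜]

/-- A family of subgroups that spans and admits a compatible family of projections is an internal
direct sum. -/
theorem isInternal_of_proj {M : Type*} [AddCommGroup M] (d : ℤ → AddSubgroup M)
    (pr : ℤ → M →+ M) (h_same : ∀ i, ∀ x ∈ d i, pr i x = x)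
    (h_ne : ∀ i j, j ≠ i → ∀ x ∈ d j, pr i x = 0) (h_top : ∀ x, x ∈ iSup d) :
    DirectSum.IsInternal d := by
  rw [isInternal_iff]
  refine ⟨fun i => ?_, (AddSubgroup.eq_top_iff' _).2 h_top⟩
  rw [AddSubgroup.disjoint_def]
  intro x hx hx'
  have h : (⨆ (j) (_ : j ≠ i), d j) ≤ (pr i).ker :=
    iSup₂_le fun j hj y hy => h_ne i j hj y hy
  rw [← h_same i x hx]
  exact h hx'

/-- The decomposition of a graded module into its homogeneous parts. -/
noncomputable def decomposeEquiv (M : GrMod.{u, v, w} 𝒜) :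
    M.carrier ≃+ DirectSum ℤ fun i => M.deg i :=
  (AddEquiv.ofBijective (DirectSum.coeAddMonoidHom M.deg)
    (show Function.Bijective _ from M.isInternal)).symm

theorem coe_decomposeEquiv (M : GrMod.{u, v, w} 𝒜) (x : M.carrier) :
    DirectSum.coeAddMonoidHom M.deg (M.decomposeEquiv x) = x :=
  AddEquiv.apply_symm_apply (AddEquiv.ofBijective (DirectSum.coeAddMonoidHom M.deg)
    (show Function.Bijective _ from M.isInternal)) x

theorem decomposeEquiv_of_mem (M : GrMod.{u, v, w} 𝒜) {i : ℤ} {x : M.carrier}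
    (hx : x ∈ M.deg i) :
    M.decomposeEquiv x = DirectSum.of (fun i => M.deg i) i ⟨x, hx⟩ := by
  refine (show Function.Bijective _ from M.isInternal).1 ?_
  rw [coe_decomposeEquiv, DirectSum.coeAddMonoidHom_of]

/-- The projection of `M` onto its part of degree `i`. -/
noncomputable def proj (M : GrMod.{u, v, w} 𝒜) (i : ℤ) : M.carrier →+ M.carrier :=
  AddMonoidHom.mk' (fun x => (M.decomposeEquiv x i : M.carrier)) fun x y => by simp

theorem proj_apply (M : GrMod.{u, v, w} 𝒜) (i : ℤ) (x : M.carrier) :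
    M.proj i x = M.decomposeEquiv x i := rfl

theorem proj_mem (M : GrMod.{u, v, w} 𝒜) (i : ℤ) (x : M.carrier) : M.proj i x ∈ M.deg i :=
  SetLike.coe_mem _

theorem proj_of_mem (M : GrMod.{u, v, w} 𝒜) {i : ℤ} {x : M.carrier} (hx : x ∈ M.deg i) :
    M.proj i x = x := by
  rw [proj_apply, decomposeEquiv_of_mem M hx, DirectSum.of_eq_same]

theorem proj_of_mem_ne (M : GrMod.{u, v, w} 𝒜) {i j : ℤ} (hij : j ≠ i) {x : M.carrier}
    (hx : x ∈ M.deg j) : M.proj i x = 0 := by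
  rw [proj_apply, decomposeEquiv_of_mem M hx, DirectSum.of_eq_of_ne _ _ _ hij.symm]
  rfl

theorem mem_iSup_deg (M : GrMod.{u, v, w} 𝒜) (x : M.carrier) : x ∈ iSup M.deg := by
  rw [((isInternal_iff M.deg).1 M.isInternal).2]
  trivial

theorem homogeneous_induction (M : GrMod.{u, v, w} 𝒜) {p : M.carrier → Prop} (x : M.carrier)
    (h0 : p 0) (hom : ∀ i, ∀ x ∈ M.deg i, p x) (hadd : ∀ x y, p x → p y → p (x + y)) : p x :=
  AddSubgroup.iSup_induction M.deg (C := p) (M.mem_iSup_deg x) hom h0 hadd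

theorem exists_eq_sum_proj (M : GrMod.{u, v, w} 𝒜) (x : M.carrier) :
    ∃ s : Finset ℤ, ∑ i ∈ s, M.proj i x = x := by
  classical
  refine ⟨(M.decomposeEquiv x).support, ?_⟩
  conv_rhs => rw [← coe_decomposeEquiv M x]
  rw [DirectSum.coeAddMonoidHom_eq_dfinsuppSum]
  rfl

theorem proj_smul (M : GrMod.{u, v, w} 𝒜) {i : ℕ} {a : A} (ha : a ∈ 𝒜 i) (j : ℤ)
    (x : M.carrier) : M.proj (i + j) (a • x) = a • M.proj j x := by
  induction x using homogeneous_induction with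
  | h0 => simp
  | hadd x y hx hy => simp only [smul_add, map_add, hx, hy]
  | hom l x hx =>
    by_cases h : l = j
    · subst h
      rw [proj_of_mem M hx, proj_of_mem M (M.smul_mem i l a x ha hx)]
    · rw [proj_of_mem_ne M h hx, proj_of_mem_ne M (by omega) (M.smul_mem i l a x ha hx), smul_zero]

@[simp]
theorem lin_comp {L M N : GrMod.{u, v, w} 𝒜} (f : L ⟶ M) (g : M ⟶ N) (x : L.carrier) :
    lin (f ≫ g) x = lin g (lin f x) := rfl

@[simp]
theorem lin_id (M : GrMod.{u, v, w} 𝒜) (x : M.carrier) : lin (𝟙 M) x = x := rfl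

theorem lin_mem {M N : GrMod.{u, v, w} 𝒜} (f : M ⟶ N) {i : ℤ} {x : M.carrier}
    (hx : x ∈ M.deg i) : lin f x ∈ N.deg i :=
  Hom.map_deg f i x hx

theorem lin_proj {M N : GrMod.{u, v, w} 𝒜} (f : M ⟶ N) (i : ℤ) (x : M.carrier) :
    lin f (M.proj i x) = N.proj i (lin f x) := by
  induction x using homogeneous_induction with
  | h0 => simp
  | hadd x y hx hy => simp only [map_add, hx, hy]
  | hom l x hx =>
    by_cases h : l = i
    · subst h
      rw [proj_of_mem M hx, proj_of_mem N (lin_mem f hx)]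
    · rw [proj_of_mem_ne M h hx, proj_of_mem_ne N h (lin_mem f hx), map_zero]

/-- Homogeneous elements lift to homogeneous elements. -/
theorem exists_mem_deg {M N : GrMod.{u, v, w} 𝒜} (f : M ⟶ N) {i : ℤ} {y : N.carrier}
    (hy : y ∈ N.deg i) (h : ∃ x, lin f x = y) : ∃ x ∈ M.deg i, lin f x = y := by
  obtain ⟨x, rfl⟩ := h
  exact ⟨M.proj i x, M.proj_mem i x, by rw [lin_proj, proj_of_mem N hy]⟩

theorem mem_deg_of_injective {M N : GrMod.{u, v, w} 𝒜} (f : M ⟶ N)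
    (hf : Function.Injective (lin f)) {i : ℤ} {x : M.carrier} (hx : lin f x ∈ N.deg i) :
    x ∈ M.deg i := by
  obtain ⟨z, hz, h⟩ := exists_mem_deg f hx ⟨x, rfl⟩
  exact hf h ▸ hz

/-- The degree-preserving part of an `A`-linear map between graded modules. -/
noncomputable def homogenize {M N : GrMod.{u, v, w} 𝒜} (f : M.carrier →ₗ[A] N.carrier) : M ⟶ N :=
  let F : M.carrier →+ N.carrier :=
    (DirectSum.toAddMonoid fun j => ((N.proj j).comp f.toAddMonoidHom).comp (M.deg j).subtype).comp
      M.decomposeEquiv.toAddMonoidHom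
  have hF : ∀ (j : ℤ) (x : M.carrier), x ∈ M.deg j → F x = N.proj j (f x) := fun j x hx => by
    change DirectSum.toAddMonoid _ (M.decomposeEquiv x) = _
    rw [decomposeEquiv_of_mem M hx, DirectSum.toAddMonoid_of]
    rfl
  show Hom M N from
  { toLinearMap :=
      { F with
        map_smul' := fun a x => by
          change F (a • x) = a • F x
          induction a using DirectSum.Decomposition.inductionOn 𝒜 with
          | zero => simp
          | add a b ha hb => simp only [add_smul, map_add, ha, hb]
          | @homogeneous i a =>
            induction x using homogeneous_induction with
            | h0 => simp
            | hadd x y hx hy => simp only [smul_add, map_add, hx, hy]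
            | hom j x hx =>
              rw [hF _ _ (M.smul_mem i j a x a.2 hx), hF _ _ hx, map_smul, proj_smul N a.2] }
    map_deg := fun j x hx => by
      change F x ∈ _
      rw [hF j x hx]
      exact proj_mem N j _ }

theorem homogenize_of_mem {M N : GrMod.{u, v, w} 𝒜} (f : M.carrier →ₗ[A] N.carrier) {j : ℤ}
    {x : M.carrier} (hx : x ∈ M.deg j) : lin (homogenize f) x = N.proj j (f x) := by
  change DirectSum.toAddMonoid _ (M.decomposeEquiv x) = _
  rw [decomposeEquiv_of_mem M hx, DirectSum.toAddMonoid_of]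
  rfl

/-- A projective graded module is projective with respect to graded surjections. -/
theorem exists_lift {P M N : GrMod.{u, v, w} 𝒜} (hP : Module.Projective A P.carrier)
    (f : M ⟶ N) (g : P ⟶ N) (hf : Function.Surjective (lin f)) :
    ∃ h : P ⟶ M, ∀ x, lin f (lin h x) = lin g x := by
  obtain ⟨h, hh⟩ := Module.projective_lifting_property (lin f) (lin g) hf
  -- The degree-preserving part of an ungraded lift is still a lift, because `f` commutes with the
  -- projections and `g` preserves degrees.
  refine ⟨homogenize h, fun x => ?_⟩
  induction x using homogeneous_induction with
  | h0 => simp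
  | hadd x y hx hy => simp only [map_add, hx, hy]
  | hom j x hx =>
    rw [homogenize_of_mem h hx, lin_proj, ← LinearMap.comp_apply, hh, proj_of_mem N (lin_mem g hx)]

/-- The kernel of a graded homomorphism. -/
def ker {M N : GrMod.{u, v, w} 𝒜} (f : M ⟶ N) : GrMod.{u, v, w} 𝒜 where
  carrier := LinearMap.ker (lin f)
  deg i := (M.deg i).comap (LinearMap.ker (lin f)).subtype.toAddMonoidHom
  isInternal := by
    have hmem : ∀ (i : ℤ) (x : LinearMap.ker (lin f)), M.proj i x ∈ LinearMap.ker (lin f) :=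
      fun i x => by rw [LinearMap.mem_ker, lin_proj, LinearMap.mem_ker.1 x.2, map_zero]
    refine isInternal_of_proj _
      (fun i => AddMonoidHom.mk' (fun x => ⟨M.proj i x, hmem i x⟩) fun x y => by
        ext; simp) ?_ ?_ ?_
    · exact fun i x hx => Subtype.ext (proj_of_mem M hx)
    · exact fun i j hij x hx => Subtype.ext (proj_of_mem_ne M hij hx)
    · intro x
      obtain ⟨s, hs⟩ := M.exists_eq_sum_proj x
      have h : x = ∑ i ∈ s, ⟨M.proj i x, hmem i x⟩ := by
        ext
        rw [AddSubmonoidClass.coe_finsetSum]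
        exact hs.symm
      rw [h]
      exact sum_mem fun i _ => AddSubgroup.mem_iSup_of_mem i (M.proj_mem i x)
  smul_mem i j a x ha hx := M.smul_mem i j a x ha hx

/-- The inclusion of the kernel. -/
def kerι {M N : GrMod.{u, v, w} 𝒜} (f : M ⟶ N) : ker f ⟶ M :=
  show Hom (ker f) M from ⟨(LinearMap.ker (lin f)).subtype, fun _ _ h => h⟩

theorem shortExactSeq_ker {M N : GrMod.{u, v, w} 𝒜} (f : M ⟶ N)
    (hf : Function.Surjective (lin f)) : ShortExactSeq (kerι f) f := by
  refine ⟨Subtype.val_injective, fun x => ?_, hf⟩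
  exact ⟨fun h => ⟨⟨x, h⟩, rfl⟩, fun ⟨y, hy⟩ => hy ▸ y.2⟩

/-- The first map of a short exact sequence is a kernel of the second. -/
theorem ShortExactSeq.exists_lift {L M N Q : GrMod.{u, v, w} 𝒜} {f : L ⟶ M} {g : M ⟶ N}
    (h : ShortExactSeq f g) (φ : Q ⟶ M) (hφ : ∀ x, lin g (lin φ x) = 0) :
    ∃ ψ : Q ⟶ L, ∀ x, lin f (lin ψ x) = lin φ x := by
  let e := LinearEquiv.ofInjective (lin f) h.1
  let ψ : Q.carrier →ₗ[A] L.carrier :=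
    e.symm.toLinearMap.comp ((lin φ).codRestrict _ fun x => (h.2.1 _).1 (hφ x))
  have hψ : ∀ x, lin f (ψ x) = lin φ x := fun x =>
    congrArg Subtype.val (e.apply_symm_apply ⟨lin φ x, (h.2.1 _).1 (hφ x)⟩)
  refine ⟨show Hom Q L from ⟨ψ, fun i x hx => ?_⟩, hψ⟩
  refine mem_deg_of_injective f h.1 ?_
  rw [hψ]
  exact lin_mem φ hx

theorem GeneratedInDegree.surjective {M N : GrMod.{u, v, w} 𝒜} {d : ℤ}
    (hN : N.GeneratedInDegree d) (f : M ⟶ N) (h : ∀ y ∈ N.deg d, ∃ x, lin f x = y) :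
    Function.Surjective (lin f) := by
  rw [← LinearMap.range_eq_top, ← top_le_iff, ← (show _ = ⊤ from hN), Submodule.span_le]
  exact fun y hy => h y hy

theorem GeneratedInDegree.of_surjective {M N : GrMod.{u, v, w} 𝒜} {d : ℤ}
    (hM : M.GeneratedInDegree d) (f : M ⟶ N) (hf : Function.Surjective (lin f)) :
    N.GeneratedInDegree d := by
  have h : Submodule.map (lin f) (Submodule.span A (M.deg d : Set M.carrier)) = ⊤ := by
    rw [show Submodule.span A (M.deg d : Set M.carrier) = ⊤ from hM, Submodule.map_top,
      LinearMap.range_eq_top.2 hf]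
  rw [Submodule.map_span] at h
  refine top_le_iff.1 (h ▸ Submodule.span_mono ?_)
  rintro _ ⟨x, hx, rfl⟩
  exact lin_mem f hx

theorem GeneratedInDegree.subsingleton {M : GrMod.{u, v, w} 𝒜} {d : ℤ}
    (hM : M.GeneratedInDegree d) (h : ∀ x ∈ M.deg d, x = 0) : Subsingleton M.carrier := by
  rw [← Submodule.subsingleton_iff A, ← subsingleton_iff_bot_eq_top, ← (show _ = ⊤ from hM), eq_comm,
    Submodule.span_eq_bot]
  exact h

/-- `A` lives in nonnegative degrees, so its action never lowers degree. -/
theorem GeneratedInDegree.eq_zero_of_mem {M : GrMod.{u, v, w} 𝒜} {d j : ℤ}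
    (hM : M.GeneratedInDegree d) (hj : j < d) : ∀ x ∈ M.deg j, x = 0 := by
  have h : ∀ x, M.proj j x = 0 := fun x => by
    have hx : x ∈ Submodule.span A (M.deg d : Set M.carrier) := by
      rw [show Submodule.span A (M.deg d : Set M.carrier) = ⊤ from hM]
      trivial
    induction hx using Submodule.closure_induction with
    | zero => exact map_zero _
    | add x y _ _ hx hy => rw [map_add, hx, hy, add_zero]
    | smul_mem a x hx =>
      induction a using DirectSum.Decomposition.inductionOn 𝒜 with
      | zero => rw [zero_smul, map_zero]
      | add a b ha hb => rw [add_smul, map_add, ha, hb, add_zero]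
      | @homogeneous n a =>
        exact proj_of_mem_ne M (by omega) (M.smul_mem n d a x a.2 hx)
  exact fun x hx => by rw [← proj_of_mem M hx, h]

end Graded

end GrMod

/-! ### Linear covers and the exact sequence of their kernels. -/

namespace GrMod

section Cover

variable {k : Type w} [Field k] {A : Type u} [Ring A] [Algebra k A]
  {𝒜 : ℕ → Submodule k A} [GradedAlgebra 𝒜]

theorem ShortExactSeq.lin_lin {L M N : GrMod.{u, v, w} 𝒜} {f : L ⟶ M} {g : M ⟶ N}
    (h : ShortExactSeq f g) (x : L.carrier) : lin g (lin f x) = 0 :=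
  (h.2.1 _).2 ⟨x, rfl⟩

/-- `0 ⟶ K ⟶ P ⟶ X ⟶ 0` is a projective cover of a module generated in degree `d`: `P` is
projective and generated in degree `d`, and `P ⟶ X` is injective in degree `d`. -/
structure IsLinearCover (d : ℤ) {K P X : GrMod.{u, v, w} 𝒜} (i : K ⟶ P) (p : P ⟶ X) : Prop where
  exact : ShortExactSeq i p
  projective : Module.Projective A P.carrier
  generated : P.GeneratedInDegree d
  eq_zero : ∀ x ∈ K.deg d, x = 0

theorem IsLinearCover.eq_zero_of_lin_eq_zero {d : ℤ} {K P X : GrMod.{u, v, w} 𝒜} {i : K ⟶ P}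
    {p : P ⟶ X} (h : IsLinearCover d i p) {x : P.carrier} (hx : x ∈ P.deg d)
    (hpx : lin p x = 0) : x = 0 := by
  obtain ⟨y, hy, rfl⟩ := exists_mem_deg i hx ((h.exact.2.1 x).1 hpx)
  rw [h.eq_zero y hy, map_zero]

/-- If `0 ⟶ X'' ⟶ X' ⟶ Y ⟶ 0` is exact and the modules are generated in degree `d`, then covers of
`X'` and `Y` induce a cover of `X''` together with an exact sequence of the kernels. -/
theorem exists_shortExactSeq_kernels {d : ℤ} {X'' X' Y K' P' K P : GrMod.{u, v, w} 𝒜}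
    {f : X'' ⟶ X'} {g : X' ⟶ Y} (hfg : ShortExactSeq f g) (hX'' : X''.GeneratedInDegree d)
    {i' : K' ⟶ P'} {p' : P' ⟶ X'} (h' : IsLinearCover d i' p')
    {i : K ⟶ P} {p : P ⟶ Y} (h : IsLinearCover d i p) :
    ∃ (K'' P'' : GrMod.{u, v, w} 𝒜) (i'' : K'' ⟶ P'') (p'' : P'' ⟶ X'') (a : K'' ⟶ K')
      (b : K' ⟶ K), IsLinearCover d i'' p'' ∧ ShortExactSeq a b := by
  obtain ⟨l, hl⟩ := exists_lift h'.projective p (p' ≫ g) h.exact.2.2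
  simp only [lin_comp] at hl
  -- Both `g` and `p'` are onto in degree `d` and `p` is injective there, so `l` is onto in degree
  -- `d`, which generates `P`.
  have hl_surj : Function.Surjective (lin l) := by
    refine h.generated.surjective l fun y hy => ?_
    obtain ⟨x, hx, hxy⟩ := exists_mem_deg g (lin_mem p hy) (hfg.2.2 _)
    obtain ⟨z, hz, hzx⟩ := exists_mem_deg p' hx (h'.exact.2.2 _)
    refine ⟨z, sub_eq_zero.1 (h.eq_zero_of_lin_eq_zero (sub_mem (lin_mem l hz) hy) ?_)⟩
    rw [map_sub, hl, hzx, hxy, sub_self]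
  have hQ := shortExactSeq_ker l hl_surj
  obtain ⟨s, hs⟩ := exists_lift h.projective l (𝟙 P) hl_surj
  simp only [lin_id] at hs
  -- Since `P` is projective, `l` splits, and `1 - s l` retracts `P'` onto `ker l`. This summand
  -- will cover `X''`.
  obtain ⟨r, hr⟩ : ∃ r : P' ⟶ ker l, ∀ x, lin (kerι l) (lin r x) = x - lin s (lin l x) := by
    refine hQ.exists_lift (show Hom P' P' from ⟨LinearMap.id - lin (l ≫ s), fun j x hx =>
      sub_mem hx (lin_mem (l ≫ s) hx)⟩) fun x => ?_
    change lin l (x - lin s (lin l x)) = 0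
    rw [map_sub, hs, sub_self]
  have hr' : ∀ x, lin r (lin (kerι l) x) = x := fun x => hQ.1 (by
    rw [hr, hQ.lin_lin, map_zero, sub_zero])
  have hQ_proj : Module.Projective A (ker l).carrier :=
    have := h'.projective
    Module.Projective.of_split (lin (kerι l)) (lin r) (LinearMap.ext hr')
  have hQ_gen : (ker l).GeneratedInDegree d :=
    h'.generated.of_surjective r fun x => ⟨_, hr' x⟩
  obtain ⟨q, hq⟩ := hfg.exists_lift (kerι l ≫ p') fun x => by
    rw [lin_comp, ← hl, hQ.lin_lin, map_zero]
  simp only [lin_comp] at hq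
  -- A preimage in degree `d` of `f y` lies in `ker l`: its image under `l` is killed by `p`, which
  -- is injective in degree `d`.
  have hq_surj : Function.Surjective (lin q) := by
    refine hX''.surjective q fun y hy => ?_
    obtain ⟨z, hz, hzy⟩ := exists_mem_deg p' (lin_mem f hy) (h'.exact.2.2 _)
    have hlz : lin l z = 0 := h.eq_zero_of_lin_eq_zero (lin_mem l hz) (by
      rw [hl, hzy, hfg.lin_lin])
    obtain ⟨t, rfl⟩ := (hQ.2.1 z).1 hlz
    exact ⟨t, hfg.1 (by rw [hq, hzy])⟩
  have hK := shortExactSeq_ker q hq_surj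
  obtain ⟨a, ha⟩ := h'.exact.exists_lift (kerι q ≫ kerι l) fun x => by
    rw [lin_comp, ← hq, hK.lin_lin, map_zero]
  obtain ⟨b, hb⟩ := h.exact.exists_lift (i' ≫ l) fun x => by
    rw [lin_comp, hl, h'.exact.lin_lin, map_zero]
  simp only [lin_comp] at ha hb
  -- What remains is the nine lemma for the kernels of the three covers; `ker q` vanishes in degree
  -- `d` because `p'` is injective there.
  refine ⟨ker q, ker l, kerι q, q, a, b, ⟨hK, hQ_proj, hQ_gen, fun x hx => ?_⟩, fun x y hxy => ?_,
    fun x => ⟨fun hx => ?_, ?_⟩, fun y => ?_⟩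
  · refine hK.1 (hQ.1 ?_)
    rw [map_zero, map_zero]
    exact h'.eq_zero_of_lin_eq_zero (lin_mem (kerι l) (lin_mem (kerι q) hx)) (by
      rw [← hq, hK.lin_lin, map_zero])
  · exact hK.1 (hQ.1 (by rw [← ha, hxy, ha]))
  · obtain ⟨t, ht⟩ := (hQ.2.1 (lin i' x)).1 (by rw [← hb, hx, map_zero])
    obtain ⟨z, rfl⟩ := (hK.2.1 t).1 (hfg.1 (by rw [hq, ht, h'.exact.lin_lin, map_zero]))
    exact ⟨z, h'.exact.1 (by rw [ha, ht])⟩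
  · rintro ⟨z, rfl⟩
    exact h.exact.1 (by rw [hb, ha, hQ.lin_lin, map_zero])
  · obtain ⟨z, hz⟩ := hl_surj (lin i y)
    obtain ⟨x, hx⟩ := (hfg.2.1 (lin p' z)).1 (by rw [← hl, hz, h.exact.lin_lin])
    obtain ⟨t, rfl⟩ := hq_surj x
    obtain ⟨c, hc⟩ := (h'.exact.2.1 (z - lin (kerι l) t)).1 (by rw [map_sub, ← hx, hq, sub_self])
    exact ⟨c, h.exact.1 (by rw [hb, hc, map_sub, hQ.lin_lin, sub_zero, hz])⟩

/-! ### Modules linear up to a given step. -/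

/-- `M` is generated in degree `d` and the kernels of its iterated projective covers are, up to the
`n`-th one, generated in degrees `d + 1`, `d + 2`, and so on. -/
def IsLinearUpTo : ℕ → ℤ → GrMod.{u, v, w} 𝒜 → Prop
  | 0, d, X => X.GeneratedInDegree d
  | n + 1, d, X => X.GeneratedInDegree d ∧
      ∀ (K P : GrMod.{u, v, w} 𝒜) (i : K ⟶ P) (p : P ⟶ X), IsLinearCover d i p →
        IsLinearUpTo n (d + 1) K

theorem IsLinearUpTo.generated {n : ℕ} {d : ℤ} {X : GrMod.{u, v, w} 𝒜}
    (h : IsLinearUpTo n d X) : X.GeneratedInDegree d := by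
  cases n with
  | zero => exact h
  | succ n => exact h.1

theorem isLinearUpTo_of_subsingleton (n : ℕ) (d : ℤ) (X : GrMod.{u, v, w} 𝒜)
    [Subsingleton X.carrier] : IsLinearUpTo n d X := by
  induction n generalizing d X with
  | zero => exact Subsingleton.elim _ _
  | succ n ih =>
    refine ⟨Subsingleton.elim _ _, fun K P i p h => ?_⟩
    have hP : Subsingleton P.carrier := h.generated.subsingleton fun x hx =>
      h.eq_zero_of_lin_eq_zero hx (Subsingleton.elim _ _)
    have : Subsingleton K.carrier := h.exact.1.subsingleton
    exact ih _ K

/-- Modules generated in degree `d` have projective covers. -/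
def HasLinearCovers (𝒜 : ℕ → Submodule k A) [GradedAlgebra 𝒜] : Prop :=
  ∀ (d : ℤ) (X : GrMod.{u, v, w} 𝒜), X.GeneratedInDegree d →
    ∃ (K P : GrMod.{u, v, w} 𝒜) (i : K ⟶ P) (p : P ⟶ X), IsLinearCover d i p

/-- Any cover of `Y` and a chosen cover of `X'` give an exact sequence of syzygies, to which
induction applies in degree `d + 1`. -/
theorem IsLinearUpTo.of_shortExactSeq (hcov : HasLinearCovers.{u, v, w} 𝒜) {n : ℕ} {d : ℤ}
    {X'' X' Y : GrMod.{u, v, w} 𝒜} {f : X'' ⟶ X'} {g : X' ⟶ Y} (hfg : ShortExactSeq f g)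
    (h'' : IsLinearUpTo n d X'') (h' : IsLinearUpTo n d X') : IsLinearUpTo n d Y := by
  induction n generalizing d X'' X' Y with
  | zero => exact GeneratedInDegree.of_surjective h' g hfg.2.2
  | succ n ih =>
    refine ⟨GeneratedInDegree.of_surjective h'.1 g hfg.2.2, fun K P i p h => ?_⟩
    obtain ⟨K', P', i', p', hc'⟩ := hcov d X' h'.1
    obtain ⟨K'', P'', i'', p'', a, b, hc'', hab⟩ := exists_shortExactSeq_kernels hfg h''.1 hc' h
    exact ih hab (h''.2 _ _ _ _ hc'') (h'.2 _ _ _ _ hc')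

/-- It suffices to test one cover. -/
theorem IsLinearUpTo.of_isLinearCover (hcov : HasLinearCovers.{u, v, w} 𝒜) {n : ℕ} {d : ℤ}
    {K P X : GrMod.{u, v, w} 𝒜} {i : K ⟶ P} {p : P ⟶ X} (h : IsLinearCover d i p)
    (hK : IsLinearUpTo n (d + 1) K) : IsLinearUpTo (n + 1) d X := by
  have hX := h.generated.of_surjective p h.exact.2.2
  refine ⟨hX, fun K₁ P₁ i₁ p₁ h₁ => ?_⟩
  -- Two covers of `X` are compared through `0 → 0 → X → X → 0`: the syzygy `K₁` is a quotient of
  -- `K` by a syzygy of the zero module.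
  have hS := shortExactSeq_ker (𝟙 X) fun x => ⟨x, rfl⟩
  have : Subsingleton (ker (𝟙 X)).carrier := ⟨fun x y => hS.1 (by
    rw [← lin_id X (lin _ x), ← lin_id X (lin _ y), hS.lin_lin, hS.lin_lin])⟩
  have hZ : ∀ n d, IsLinearUpTo n d (ker (𝟙 X)) := fun n d => isLinearUpTo_of_subsingleton n d _
  obtain ⟨K'', P'', i'', p'', a, b, hc'', hab⟩ :=
    exists_shortExactSeq_kernels hS (hZ 0 d) h h₁
  exact IsLinearUpTo.of_shortExactSeq hcov hab ((hZ (n + 1) d).2 _ _ _ _ hc'') hK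

/-- Linearity is invariant under regrading. A cover of `Y` shifted by `-e` covers `X`, and on its
kernel the identity map again raises degrees by `e`, so the induction closes. -/
theorem IsLinearUpTo.of_linearEquiv {n : ℕ} {d : ℤ} (e : ℤ) {X Y : GrMod.{u, v, w} 𝒜}
    (φ : X.carrier ≃ₗ[A] Y.carrier) (hφ : ∀ j x, φ x ∈ Y.deg (j + e) ↔ x ∈ X.deg j)
    (h : IsLinearUpTo n d X) : IsLinearUpTo n (d + e) Y := by
  have hgen : Y.GeneratedInDegree (d + e) := by
    have h1 : Submodule.map φ.toLinearMap (Submodule.span A (X.deg d : Set X.carrier)) = ⊤ := by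
      rw [show Submodule.span A (X.deg d : Set X.carrier) = ⊤ from h.generated, Submodule.map_top,
        LinearEquiv.range]
    rw [Submodule.map_span] at h1
    refine top_le_iff.1 (h1 ▸ Submodule.span_mono ?_)
    rintro _ ⟨x, hx, rfl⟩
    exact (hφ d x).2 hx
  induction n generalizing d X Y with
  | zero => exact hgen
  | succ n ih =>
    refine ⟨hgen, fun K P i p hc => ?_⟩
    have hdeg : ∀ (M : GrMod.{u, v, w} 𝒜) (j : ℤ) (x : M.carrier),
        x ∈ M.deg (j + e) ↔ x ∈ (M.shift (-e)).deg j := fun M j x => by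
      change _ ↔ x ∈ M.deg (j - -e)
      rw [sub_neg_eq_add]
    let i₁ : K.shift (-e) ⟶ P.shift (-e) :=
      show Hom _ _ from ⟨lin (M := K) (N := P) i, fun j x hx => lin_mem (M := K) (N := P) i hx⟩
    let p₁ : P.shift (-e) ⟶ X :=
      show Hom _ _ from ⟨φ.symm.toLinearMap.comp (lin (M := P) (N := Y) p), fun j x hx => by
        refine (hφ j _).1 ?_
        change φ (φ.symm (lin (M := P) (N := Y) p x)) ∈ _
        rw [φ.apply_symm_apply]
        exact lin_mem (M := P) (N := Y) p ((hdeg P j x).2 hx)⟩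
    have hc₁ : IsLinearCover d i₁ p₁ := by
      refine ⟨⟨hc.exact.1, fun x => ?_, φ.symm.surjective.comp hc.exact.2.2⟩, hc.projective, ?_,
        fun x hx => hc.eq_zero x ((hdeg K d x).2 hx)⟩
      · exact (show φ.symm (lin (M := P) (N := Y) p x) = 0 ↔ _ from φ.symm.map_eq_zero_iff).trans (hc.exact.2.1 x)
      · have := hc.generated
        change Submodule.span A (P.deg (d - -e) : Set P.carrier) = ⊤
        rw [sub_neg_eq_add]
        exact this
    have hK₁ := h.2 _ _ _ _ hc₁
    have hφK : ∀ (j : ℤ) (x : (K.shift (-e)).carrier),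
      LinearEquiv.refl A K.carrier x ∈ K.deg (j + e) ↔ x ∈ (K.shift (-e)).deg j := hdeg K
    rw [show d + e + 1 = d + 1 + e by ring]
    refine ih (X := K.shift (-e)) (LinearEquiv.refl A K.carrier) hφK hK₁ ?_
    have h2 := hK₁.generated
    change Submodule.span A (K.deg (d + 1 - -e) : Set K.carrier) = ⊤ at h2
    rw [sub_neg_eq_add] at h2
    exact h2

/-- Linearity up to every `n` is inherited by the syzygy, so covers can be chosen forever; the
differential is the composite `P (m + 1) → K m → P m`. -/
theorem exists_linearResolution (hcov : HasLinearCovers.{u, v, w} 𝒜) (X : GrMod.{u, v, w} 𝒜)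
    (hX : ∀ n, IsLinearUpTo n 0 X) : X.IsKoszul := by
  have hcov' : ∀ (m : ℕ) (M : {M : GrMod.{u, v, w} 𝒜 // ∀ n, IsLinearUpTo n (m : ℤ) M}),
      ∃ (K : {M : GrMod.{u, v, w} 𝒜 // ∀ n, IsLinearUpTo n ((m + 1 : ℕ) : ℤ) M})
        (P : GrMod.{u, v, w} 𝒜) (i : K.1 ⟶ P) (p : P ⟶ M.1), IsLinearCover (m : ℤ) i p := by
    rintro m ⟨M, hM⟩
    obtain ⟨K, P, i, p, h⟩ := hcov m M (hM 0)
    exact ⟨⟨K, fun n => by rw [Nat.cast_succ]; exact (hM (n + 1)).2 _ _ _ _ h⟩, P, i, p, h⟩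
  choose K P i p h using hcov'
  let S : ∀ m : ℕ, {M : GrMod.{u, v, w} 𝒜 // ∀ n, IsLinearUpTo n (m : ℤ) M} := fun m =>
    Nat.rec ⟨X, hX⟩ (fun m M => K m M) m
  refine ⟨{
    P := fun m => P m (S m)
    d := fun m => p (m + 1) (S (m + 1)) ≫ i m (S m)
    ε := p 0 (S 0)
    projective := fun m => (h m (S m)).projective
    generated := fun m => (h m (S m)).generated
    surjective := (h 0 (S 0)).exact.2.2
    exact_zero := fun x => ?_
    exact_succ := fun m x => ?_ }⟩
  · refine ((h 0 (S 0)).exact.2.1 x).trans ⟨?_, ?_⟩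
    · rintro ⟨y, rfl⟩
      obtain ⟨z, rfl⟩ := (h 1 (S 1)).exact.2.2 y
      exact ⟨z, rfl⟩
    · rintro ⟨z, rfl⟩
      exact ⟨_, rfl⟩
  · have h0 : lin (p (m + 1) (S (m + 1)) ≫ i m (S m)) x = 0 ↔ lin (p (m + 1) (S (m + 1))) x = 0 :=
      map_eq_zero_iff _ (h m (S m)).exact.1
    refine h0.trans (((h (m + 1) (S (m + 1))).exact.2.1 x).trans ⟨?_, ?_⟩)
    · rintro ⟨y, rfl⟩
      obtain ⟨z, rfl⟩ := (h (m + 2) (S (m + 2))).exact.2.2 y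
      exact ⟨z, rfl⟩
    · rintro ⟨z, rfl⟩
      exact ⟨_, rfl⟩

end Cover

end GrMod

/-! ### Existence of linear covers when `A_0` is semisimple. -/

/-- A submodule of a semisimple module is the kernel of an idempotent endomorphism. -/
theorem IsSemisimpleModule.exists_idempotent {R M : Type*} [Ring R] [AddCommGroup M] [Module R M]
    [IsSemisimpleModule R M] (N : Submodule R M) :
    ∃ e : M →ₗ[R] M, (∀ x ∈ N, e x = 0) ∧ (∀ x, x - e x ∈ N) ∧ ∀ x, e (e x) = e x := by
  obtain ⟨r, hr⟩ := extension_property N.subtype N.subtype_injective LinearMap.id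
  have h0 : ∀ x ∈ N, (LinearMap.id - N.subtype.comp r : M →ₗ[R] M) x = 0 := fun x hx => by
    have h := LinearMap.congr_fun hr ⟨x, hx⟩
    rw [LinearMap.sub_apply, sub_eq_zero]
    exact (congrArg Subtype.val h).symm
  have h1 : ∀ x, x - (LinearMap.id - N.subtype.comp r : M →ₗ[R] M) x ∈ N := fun x => by
    rw [LinearMap.sub_apply, LinearMap.id_apply, sub_sub_cancel]
    exact (r x).2
  refine ⟨LinearMap.id - N.subtype.comp r, h0, h1, fun x => ?_⟩
  have h2 := h0 _ (h1 x)
  rwa [map_sub, sub_eq_zero, eq_comm] at h2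

namespace GrMod

section Free

variable {k : Type w} [Field k] {A : Type u} [Ring A] [Algebra k A]
  (𝒜 : ℕ → Submodule k A) [GradedAlgebra 𝒜]

/-- The projection of `A` onto its part of degree `j ∈ ℤ`, which is zero for `j < 0`. -/
noncomputable def algProj (j : ℤ) : A →+ A :=
  if 0 ≤ j then GradedRing.proj 𝒜 j.toNat else 0

theorem algProj_natCast (n : ℕ) (a : A) :
    algProj 𝒜 (n : ℤ) a = DirectSum.decompose 𝒜 a n := by
  simp [algProj]

theorem algProj_of_mem {n : ℕ} {a : A} (ha : a ∈ 𝒜 n) : algProj 𝒜 (n : ℤ) a = a := by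
  rw [algProj_natCast, DirectSum.decompose_of_mem_same 𝒜 ha]

theorem algProj_of_mem_ne {n : ℕ} {j : ℤ} (h : (n : ℤ) ≠ j) {a : A} (ha : a ∈ 𝒜 n) :
    algProj 𝒜 j a = 0 := by
  by_cases hj : 0 ≤ j
  · lift j to ℕ using hj
    rw [algProj_natCast, DirectSum.decompose_of_mem_ne 𝒜 ha (by exact_mod_cast h)]
  · simp [algProj, hj]

/-- Being homogeneous of degree `j`, where the zero element is the only one if `j < 0`. -/
theorem algProj_eq_self_iff (j : ℤ) (a : A) :
    algProj 𝒜 j a = a ↔ a = 0 ∨ ∃ n : ℕ, (n : ℤ) = j ∧ a ∈ 𝒜 n := by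
  constructor
  · intro h
    by_cases hj : 0 ≤ j
    · lift j to ℕ using hj
      refine Or.inr ⟨j, rfl, ?_⟩
      rw [← h, algProj_natCast]
      exact SetLike.coe_mem _
    · exact Or.inl (by rw [← h]; simp [algProj, hj])
  · rintro (rfl | ⟨n, rfl, ha⟩)
    · exact map_zero _
    · exact algProj_of_mem 𝒜 ha

/-- The free graded module on generators of degree `d` indexed by `I`. -/
noncomputable def free (d : ℤ) (I : Type v) : GrMod.{u, max u v, w} 𝒜 where
  carrier := I →₀ A
  deg j :=
    -- Being fixed by `algProj` treats all integers `j` uniformly: for `j < d` the projection is 0,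
    -- leaving only `v = 0`.
    { carrier := {v | ∀ x, algProj 𝒜 (j - d) (v x) = v x}
      zero_mem' := fun x => map_zero _
      add_mem' := fun {v w} hv hw x => by rw [Finsupp.add_apply, map_add, hv x, hw x]
      neg_mem' := fun {v} hv x => by rw [Finsupp.neg_apply, map_neg, hv x] }
  isInternal := by
    refine isInternal_of_proj _ (fun j => Finsupp.mapRange.addMonoidHom (algProj 𝒜 (j - d)))
      ?_ ?_ ?_
    · exact fun i v hv => Finsupp.ext hv
    · refine fun i j hij v hv => Finsupp.ext fun x => ?_
      change algProj 𝒜 (i - d) (v x) = 0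
      rcases (algProj_eq_self_iff 𝒜 _ _).1 (hv x) with h | ⟨n, hn, h⟩
      · rw [h, map_zero]
      · exact algProj_of_mem_ne 𝒜 (by omega) h
    · intro v
      induction v using Finsupp.induction_linear with
      | zero => exact zero_mem _
      | add v w hv hw => exact add_mem hv hw
      | single x a =>
        induction a using DirectSum.Decomposition.inductionOn 𝒜 with
        | zero => simp
        | add a b ha hb => rw [Finsupp.single_add]; exact add_mem ha hb
        | @homogeneous n a =>
          refine AddSubgroup.mem_iSup_of_mem (n + d) fun y => ?_
          rw [add_sub_cancel_right, algProj_eq_self_iff]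
          by_cases hxy : x = y
          · subst hxy
            exact Or.inr ⟨n, rfl, by simp⟩
          · exact Or.inl (Finsupp.single_eq_of_ne' hxy)
  smul_mem i j a v ha hv x := by
    rw [Finsupp.smul_apply, smul_eq_mul, algProj_eq_self_iff]
    rcases (algProj_eq_self_iff 𝒜 _ _).1 (hv x) with h | ⟨n, hn, h⟩
    · exact Or.inl (by rw [h, mul_zero])
    · exact Or.inr ⟨i + n, by push_cast; omega, SetLike.mul_mem_graded ha h⟩

variable {𝒜}

/-- The generators of the free module. -/
noncomputable def freeGen (𝒜 : ℕ → Submodule k A) [GradedAlgebra 𝒜] (d : ℤ) {I : Type v} (x : I) :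
    (free 𝒜 d I).carrier :=
  Finsupp.single x (1 : A)

theorem freeGen_mem (d : ℤ) {I : Type v} (x : I) : freeGen 𝒜 d x ∈ (free 𝒜 d I).deg d := fun y => by
  rw [sub_self, algProj_eq_self_iff]
  refine Or.inr ⟨0, rfl, ?_⟩
  change Finsupp.single x (1 : A) y ∈ 𝒜 0
  by_cases hxy : x = y
  · subst hxy
    rw [Finsupp.single_eq_same]
    exact SetLike.one_mem_graded 𝒜
  · rw [Finsupp.single_eq_of_ne' hxy]
    exact zero_mem _

theorem free_generatedInDegree (d : ℤ) (I : Type v) : (free 𝒜 d I).GeneratedInDegree d := by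
  refine top_le_iff.1 fun v _ => ?_
  induction v using Finsupp.induction_linear with
  | zero => exact zero_mem _
  | add v w hv hw => exact add_mem (hv trivial) (hw trivial)
  | single x a =>
    have h : Finsupp.single x a = a • Finsupp.single x (1 : A) := by simp
    rw [h]
    exact Submodule.smul_mem _ a (Submodule.subset_span (freeGen_mem d x))

instance free_projective (d : ℤ) (I : Type v) : Module.Projective A (free 𝒜 d I).carrier :=
  inferInstanceAs (Module.Projective A (I →₀ A))

/-- The graded map from a free module given by the images of the generators. -/
noncomputable def freeLift {d : ℤ} {I : Type v} {N : GrMod.{u, max u v, w} 𝒜}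
    (n : I → N.carrier) (hn : ∀ x, n x ∈ N.deg d) : free 𝒜 d I ⟶ N :=
  show Hom (free 𝒜 d I) N from
  { toLinearMap := Finsupp.linearCombination A n
    map_deg := fun j v hv => by
      change v.sum (fun x a => a • n x) ∈ N.deg j
      refine sum_mem fun x _ => ?_
      dsimp only
      rcases (algProj_eq_self_iff 𝒜 _ _).1 (hv x) with h | ⟨i, hi, h⟩
      · rw [h, zero_smul]
        exact zero_mem _
      · have := N.smul_mem i d _ _ h (hn x)
        rwa [show (i : ℤ) + d = j by omega] at this }

theorem freeLift_freeGen {d : ℤ} {I : Type v} {N : GrMod.{u, max u v, w} 𝒜}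
    (n : I → N.carrier) (hn : ∀ x, n x ∈ N.deg d) (x : I) :
    lin (freeLift n hn) (freeGen 𝒜 d x) = n x :=
  (Finsupp.linearCombination_single A _ _).trans (one_smul A _)

section ZeroIncl

variable {R : Type u} [Ring R] (ρ : R →+* A)

/-- The inclusion of `R ^ I` in the free module on `I`, which is the part of degree `d` if `R` is
identified with `A_0`. -/
noncomputable def zeroIncl (𝒜 : ℕ → Submodule k A) [GradedAlgebra 𝒜] (d : ℤ) (I : Type v) :
    (I →₀ R) →+ (free 𝒜 d I).carrier :=
  show (I →₀ R) →+ (I →₀ A) from Finsupp.mapRange.addMonoidHom ρ.toAddMonoidHom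

theorem zeroIncl_single {d : ℤ} {I : Type v} (x : I) (a : R) :
    zeroIncl ρ 𝒜 d I (Finsupp.single x a) = ρ a • freeGen 𝒜 d x :=
  (Finsupp.mapRange_single (hf := map_zero _)).trans
    (show Finsupp.single x (ρ a) = ρ a • Finsupp.single x (1 : A) by simp)

theorem zeroIncl_smul {d : ℤ} {I : Type v} (a : R) (w : I →₀ R) :
    zeroIncl ρ 𝒜 d I (a • w) = ρ a • zeroIncl ρ 𝒜 d I w :=
  Finsupp.ext fun _ => map_mul ρ _ _

variable {ρ}

theorem zeroIncl_mem (hρ : ∀ a, a ∈ 𝒜 0 ↔ a ∈ Set.range ρ) (d : ℤ) {I : Type v} (w : I →₀ R) :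
    zeroIncl ρ 𝒜 d I w ∈ (free 𝒜 d I).deg d := fun x => by
  rw [sub_self, algProj_eq_self_iff]
  exact Or.inr ⟨0, rfl, (hρ _).2 ⟨w x, rfl⟩⟩

theorem exists_zeroIncl_eq (hρ : ∀ a, a ∈ 𝒜 0 ↔ a ∈ Set.range ρ) {d : ℤ} {I : Type v}
    {v : (free 𝒜 d I).carrier} (hv : v ∈ (free 𝒜 d I).deg d) :
    ∃ w, zeroIncl ρ 𝒜 d I w = v := by
  let v' : I →₀ A := v
  have h : ∀ x, ∃ r, ρ r = v' x := fun x => by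
    have hx := hv x
    rw [sub_self, algProj_eq_self_iff] at hx
    rcases hx with h | ⟨n, hn, h⟩
    · exact ⟨0, by rw [map_zero]; exact h.symm⟩
    · rw [show n = 0 by exact_mod_cast hn] at h
      exact (hρ _).1 h
  choose r hr using h
  refine ⟨v'.sum fun x _ => Finsupp.single x (r x), ?_⟩
  rw [Finsupp.sum, map_sum]
  refine Eq.trans (Finset.sum_congr rfl fun x _ => ?_) v'.sum_single
  refine (Finsupp.mapRange_single (hf := map_zero _)).trans ?_
  exact congrArg _ (hr x)

end ZeroIncl

/-- If `A_0` is semisimple, then modules generated in a single degree have projective covers. -/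
theorem hasLinearCovers {R : Type u} [Ring R] [IsSemisimpleRing R] (ρ : R →+* A)
    (hρ : ∀ a, a ∈ 𝒜 0 ↔ a ∈ Set.range ρ) : HasLinearCovers.{u, max u v, w} 𝒜 := by
  intro d X hX
  let I := X.deg d
  let F : GrMod.{u, max u v, w} 𝒜 := free 𝒜 d I
  let ι : (I →₀ R) →+ F.carrier := zeroIncl ρ 𝒜 d I
  have hι : ∀ (a : R) w, ι (a • w) = ρ a • ι w := zeroIncl_smul ρ
  let π : F ⟶ X := freeLift (fun x : I => (x : X.carrier)) fun x => x.2
  -- `N` consists of the degree `d` relations among the generators. A complement of `N`, cut out by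
  -- the idempotent `e`, is what the cover should have in degree `d`.
  let N : Submodule R (I →₀ R) :=
    { ((lin π).toAddMonoidHom.comp ι).ker with
      smul_mem' := fun a w hw => by
        change lin π (ι w) = 0 at hw
        change lin π (ι (a • w)) = 0
        rw [hι, map_smul, hw, smul_zero] }
  have hN : ∀ w, w ∈ N ↔ lin π (ι w) = 0 := fun w => Iff.rfl
  obtain ⟨e, heN, heS, hee⟩ := IsSemisimpleModule.exists_idempotent N
  -- `E` extends `e` to an `A`-linear idempotent of `F`. Its image, a projective summand, is
  -- realised as the kernel of `D = 1 - E`.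
  let E : F ⟶ F := freeLift (fun x : I => ι (e (Finsupp.single x 1))) fun x => zeroIncl_mem hρ d _
  have hE : ∀ w, lin E (ι w) = ι (e w) := fun w => by
    induction w using Finsupp.induction_linear with
    | zero => rw [map_zero, map_zero, map_zero, map_zero]
    | add v w hv hw => rw [map_add, map_add, map_add, map_add, hv, hw]
    | single x a =>
      have h1 : ι (Finsupp.single x a) = ρ a • freeGen 𝒜 d x := zeroIncl_single ρ x a
      have h2 : lin E (freeGen 𝒜 d x) = ι (e (Finsupp.single x 1)) := freeLift_freeGen _ _ x
      rw [h1, map_smul, h2, ← hι, ← map_smul, Finsupp.smul_single, smul_eq_mul, mul_one]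
  have hEE : ∀ v, lin E (lin E v) = lin E v := by
    have h : (lin E).comp (lin E) = lin E := by
      refine LinearMap.ext_on (free_generatedInDegree d I) fun v hv => ?_
      obtain ⟨w, rfl⟩ := exists_zeroIncl_eq hρ hv
      change lin E (lin E (ι w)) = lin E (ι w)
      rw [hE, hE, hee]
    exact LinearMap.congr_fun h
  let D : F ⟶ F := show Hom F F from ⟨LinearMap.id - lin E, fun j x hx =>
    sub_mem hx (lin_mem E hx)⟩
  have hD : ∀ v, lin D v = v - lin E v := fun v => rfl
  let r : F ⟶ ker D := show Hom F (ker D) from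
    ⟨(lin E).codRestrict (LinearMap.ker (lin D)) fun v => by
      rw [LinearMap.mem_ker, hD, hEE, sub_self], fun j x hx => lin_mem E hx⟩
  have hr : ∀ v, lin (kerι D) (lin r v) = lin E v := fun v => rfl
  have hED : ∀ v, lin E (lin (kerι D) v) = lin (kerι D) v := fun v =>
    (sub_eq_zero.1 (show _ - _ = _ from v.2)).symm
  have hrD : ∀ v, lin r (lin (kerι D) v) = v := fun v => Subtype.ext (hED v)
  -- A generator and its image under `E` differ by a relation, so `π` takes both to `y`.
  have hp_surj : Function.Surjective (lin (kerι D ≫ π)) := by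
    refine hX.surjective _ fun y hy => ⟨lin r (ι (Finsupp.single ⟨y, hy⟩ 1)), ?_⟩
    have h := (hN _).1 (heS (Finsupp.single ⟨y, hy⟩ 1))
    rw [map_sub, map_sub, sub_eq_zero] at h
    have h1 : ι (Finsupp.single ⟨y, hy⟩ 1) = ρ 1 • freeGen 𝒜 d ⟨y, hy⟩ := zeroIncl_single ρ _ _
    have h2 : lin π (freeGen 𝒜 d ⟨y, hy⟩) = y := freeLift_freeGen _ _ _
    rw [lin_comp, hr, hE, ← h, h1, map_one, one_smul, h2]
  have hex := shortExactSeq_ker (kerι D ≫ π) hp_surj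
  refine ⟨_, _, kerι (kerι D ≫ π), kerι D ≫ π, hex, ?_, ?_, fun x hx => hex.1 ?_⟩
  · have : Module.Projective A F.carrier := free_projective d I
    exact Module.Projective.of_split (lin (kerι D)) (lin r) (LinearMap.ext hrD)
  · exact (free_generatedInDegree d I).of_surjective r fun x => ⟨_, hrD x⟩
  -- An element of the kernel in degree `d` comes from some `w` in `N`; it is fixed by `E`, yet `e w
  -- = 0`.
  · have hx0 := hex.lin_lin x
    obtain ⟨w, hw⟩ := exists_zeroIncl_eq hρ (lin_mem (kerι D) (lin_mem (kerι (kerι D ≫ π)) hx))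
    change ι w = _ at hw
    rw [lin_comp, ← hw, ← hN] at hx0
    rw [map_zero, ← hrD (lin (kerι (kerι D ≫ π)) x)]
    refine Subtype.ext ?_
    change lin E _ = 0
    rw [← hw, hE, heN w hx0, map_zero]

end Free

end GrMod

/-! ### The induction over `C`. -/

theorem lemma3p1 {k : Type w} [Field k] {A : Type u} [Ring A] [Algebra k A]
    (𝒜 : ℕ → Submodule k A) [GradedAlgebra 𝒜] (hA : GrMod.IsKoszulAlgebra 𝒜)
    (C : ObjectProperty (GrMod.{u, max u v, w} 𝒜))
    (hC : ∀ X : GrMod.{u, max u v, w} 𝒜, C X →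
      ∃ (Ω P X' X'' : GrMod.{u, max u v, w} 𝒜)
        (i : Ω ⟶ P) (p : P ⟶ X) (f : X'' ⟶ X') (g : X' ⟶ Ω.shift (-1)),
        GrMod.ShortExactSeq i p ∧ GrMod.ShortExactSeq f g ∧
        Module.Projective A P.carrier ∧ P.GeneratedInDegree 0 ∧
        C X' ∧ C X'') :
    ∀ X : GrMod.{u, max u v, w} 𝒜, C X → X.IsKoszul := by
  have : IsSemisimpleRing (SetLike.GradeZero.subring 𝒜) := hA.1
  have hcov : GrMod.HasLinearCovers.{u, max u v, w} 𝒜 := 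
    GrMod.hasLinearCovers (SetLike.GradeZero.subring 𝒜).subtype fun _ =>
      ⟨fun h => ⟨⟨_, h⟩, rfl⟩, fun ⟨x, hx⟩ => hx ▸ x.2⟩
  have hlin : ∀ n X, C X → GrMod.IsLinearUpTo n 0 X := by
    intro n
    induction n with
    | zero =>
      intro X hX
      obtain ⟨Ω, P, X', X'', i, p, f, g, hip, hfg, hP, hgen, hX', hX''⟩ := hC X hX
      exact hgen.of_surjective p hip.2.2
    | succ n ih =>
      intro X hX
      obtain ⟨Ω, P, X', X'', i, p, f, g, hip, hfg, hP, hgen, hX', hX''⟩ := hC X hX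
      have hS := GrMod.IsLinearUpTo.of_shortExactSeq hcov hfg (ih _ hX'') (ih _ hX')
      -- Undoing the shift: linearity of `Ω[-1]` from degree 0 is linearity of `Ω` from degree 1.
      have hΩ : GrMod.IsLinearUpTo n (0 + 1) Ω := by
        refine GrMod.IsLinearUpTo.of_linearEquiv (X := Ω.shift (-1)) 1
          (LinearEquiv.refl A Ω.carrier) (fun j x => ?_) hS
        change x ∈ Ω.deg (j + 1) ↔ x ∈ Ω.deg (j - -1)
        rw [sub_neg_eq_add]
      -- Generation in degree 1 forces `Ω` to vanish in degree 0, which makes the given `P → X` a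
      -- linear cover.
      exact GrMod.IsLinearUpTo.of_isLinearCover hcov
        ⟨hip, hP, hgen, hΩ.generated.eq_zero_of_mem (by norm_num)⟩ hΩ
  exact fun X hX => GrMod.exists_linearResolution hcov X fun n => hlin n X hX
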